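/- Two groups $A,B$ with $r_A,r_B\in(0,1)$, $r_A+r_B=1$, and $p_A,p_B\in(0,1)$; put $d=p_A-p_B$. Let $\kappa\in[-1,1]$ and let $\zeta:[-1,1]\to[0,1]$ be an energy function with pivot $\kappa$, i.e. $\zeta$ is continuously differentiable, $\zeta'(c)\le 0$ for $c<\kappa$, $\zeta'(c)\ge 0$ for $c>\kappa$, $\zeta(\kappa)=\zeta'(\kappa)=0$, and $\zeta(-1),\zeta(1)>0$. At each time $t=1,2,\dots$, given the past, a group $G_t\in\{A,B\}$ is drawn with $\mathbb P(G_t=g)=r_g$, independently of the past; then a raw decision $X_t\sim\mathrm{Bernoulli}(p_{G_t})$ is drawn; then the energy shield flips it ($Y_t=1$) or keeps it ($Y_t=0$), and $Z_t=(1-X_t)Y_t+X_t(1-Y_t)$ is released. Let $$M_t=M_{A,t}-M_{B,t},\qquad M_{g,t}=\frac{\sum_{i\le t}Z_i\mathbf 1[G_i=g]}{\sum_{i\le t}\mathbf 1[G_i=g]}$$ (with $M_{g,t}=0$ while group $g$ has not occurred, so $M_0=0$). If $M_{t-1}\le\kappa$ the shield favours $1$ for group $A$ and $0$ for group $B$;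 if $M_{t-1}>\kappa$ it favours $0$ for group $A$ and $1$ for group $B$. Given the past, $G_t$ and $X_t$, it keeps $X_t$ if $X_t$ is the favoured decision and flips it with probability $\zeta(M_{t-1})$ otherwise. Let $\nu_t=\frac1t\sum_{i=1}^tY_i$ be the average interference cost. Theorem. Let $\mu^*\in[-1,1]$. (1) $M_t\to\mu^*$ almost surely if and only if $\mu^*$ lies in the closed interval between $d$ and $\kappa$ and $$\zeta(\mu^*)=\begin{cases}(\mu^*-d)/(1-d)&\text{if } d<\mu^*,\\ (d-\mu^*)/(1+d)&\text{otherwise.}\end{cases}$$ (2) The expected interference cost $\mathbb E[\nu_t]$ converges as $t\to\infty$. If $M_t\to\mu^*$ almost surely, then its limit is strictly smaller than $|\mu^*-d|$ when $\mu^*\ne d$, and is $0$ when $\mu^*=d$. -/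

import Mathlib

open Filter Topology MeasureTheory

noncomputable section

namespace FairShield

/-- The two demographic groups. -/
inductive Demographic where
  | A
  | B
  deriving DecidableEq

instance : MeasurableSpace Demographic := ⊤

/-- One time step: the group of the individual, the raw decision of the decision maker
(`true` is acceptance), and the intervention of the shield (`true` is a flip). -/
abbrev Step := Demographic × Bool × Bool

/-- The released decision `z = (1 - x) * y + x * (1 - y)`: the raw decision `x`, flipped
exactly if the intervention `y` is `true`. -/
def released (x y : Bool) : Bool := xor x y

/-- The sequence of pairs (group, released decision) of a history. -/
def releasedHistory (h : List Step) : List (Demographic × Bool) :=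
  h.map fun s => (s.1, released s.2.1 s.2.2)

/-- Empirical acceptance rate of group `g` in a sequence of group-decision pairs. It is `0`
as long as `g` has not occurred. -/
def acceptanceRate (w : List (Demographic × Bool)) (g : Demographic) : ℝ :=
  (w.count (g, true) : ℝ) / ((w.map Prod.fst).count g : ℝ)

/-- Difference of the empirical acceptance rates of the two groups. -/
def rateDifference (w : List (Demographic × Bool)) : ℝ :=
  acceptanceRate w Demographic.A - acceptanceRate w Demographic.B

/-- A probabilistic shield: from the past steps, the current group and the current raw
decision it computes the probability of flipping the current raw decision. -/
abbrev Shield := List Step → Demographic → Bool → ℝ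

/-- Energy functions `[-1, 1] → [0, 1]` with pivot `κ`, as real functions of which only the
restriction to `[-1, 1]` matters. Derivatives are taken within `[-1, 1]`, that is, they are
one-sided at the end points. -/
structure IsEnergyFunction (ζ : ℝ → ℝ) (κ : ℝ) : Prop where
  pivot_mem : κ ∈ Set.Icc (-1 : ℝ) 1
  maps_to : ∀ c ∈ Set.Icc (-1 : ℝ) 1, ζ c ∈ Set.Icc (0 : ℝ) 1
  differentiable : DifferentiableOn ℝ ζ (Set.Icc (-1) 1)
  continuous_deriv : ContinuousOn (derivWithin ζ (Set.Icc (-1) 1)) (Set.Icc (-1) 1)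
  deriv_nonpos : ∀ c ∈ Set.Icc (-1 : ℝ) 1, c < κ → derivWithin ζ (Set.Icc (-1) 1) c ≤ 0
  deriv_nonneg : ∀ c ∈ Set.Icc (-1 : ℝ) 1, κ < c → 0 ≤ derivWithin ζ (Set.Icc (-1) 1) c
  pivot_eq_zero : ζ κ = 0
  deriv_pivot_eq_zero : derivWithin ζ (Set.Icc (-1) 1) κ = 0
  left_pos : 0 < ζ (-1)
  right_pos : 0 < ζ 1

/-- The decision that the energy shield favours for group `g` at rate difference `m`: if
`m ≤ κ`, the difference should increase, so accept in group `A` and reject in group `B`;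
if `m > κ`, it should decrease, so reject in group `A` and accept in group `B`. -/
def favoured (κ m : ℝ) : Demographic → Bool
  | Demographic.A => decide (m ≤ κ)
  | Demographic.B => decide (κ < m)

/-- The energy shield: the favoured decision is kept, the other one is flipped with
probability `ζ m`, where `m` is the rate difference of the decisions released so far. -/
def energyShield (ζ : ℝ → ℝ) (κ : ℝ) : Shield := fun h g x =>
  if x = favoured κ (rateDifference (releasedHistory h)) g then 0
  else ζ (rateDifference (releasedHistory h))

/-- Mass function of the Bernoulli distribution with parameter `q`. -/
def bernoulliMass (q : ℝ) (b : Bool) : ℝ := if b then q else 1 - q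

section Dynamics

variable {Ω : Type*} (G : ℕ → Ω → Demographic) (X Y : ℕ → Ω → Bool)

/-- The list of the first `t` steps. The steps are indexed from `0`: step `i` is that of the
`(i + 1)`-st individual. -/
def history (t : ℕ) (ω : Ω) : List Step :=
  (List.range t).map fun i => (G i ω, X i ω, Y i ω)

/-- The shielded fairness process: the difference of the group acceptance rates of the first
`t` released decisions. -/
def fairness (t : ℕ) (ω : Ω) : ℝ := rateDifference (releasedHistory (history G X Y t ω))

/-- The average interference cost of the first `t` steps. -/
def averageCost (t : ℕ) (ω : Ω) : ℝ :=
  (∑ i ∈ Finset.range t, if Y i ω then (1 : ℝ) else 0) / t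

/-- `(G, X, Y)` is the group, decision and intervention process of the shield `S`, for group
probabilities `r` and acceptance probabilities `p`: given any past history `h` (of any
length), the next group is `g` with probability `r g`, independently of `h`; then the raw
decision is Bernoulli with parameter `p g`; then the intervention is Bernoulli with parameter
`S h g x`. -/
structure IsShieldedProcess [MeasurableSpace Ω] (P : Measure Ω) (r p : Demographic → ℝ)
    (S : Shield) : Prop where
  measurable_group : ∀ t, Measurable (G t)
  measurable_decision : ∀ t, Measurable (X t)
  measurable_intervention : ∀ t, Measurable (Y t)
  law : ∀ (t : ℕ) (h : List Step) (g : Demographic) (x y : Bool),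
    P.real {ω | history G X Y t ω = h ∧ G t ω = g ∧ X t ω = x ∧ Y t ω = y} =
      P.real {ω | history G X Y t ω = h} *
        (r g * bernoulliMass (p g) x * bernoulliMass (S h g x) y)

end Dynamics

end FairShield

end

/-!
Given the past, the acceptance probabilities of the two groups differ by `drift ζ κ d m`, where `m`
is the current rate difference. As `ζ` vanishes at `κ`, is antitone before it and monotone after it,
`drift ζ κ d` is a continuous antitone self-map of `[-1, 1]`. It therefore has a unique fixed point,
and the criterion of the theorem says precisely that `μ` is this fixed point
(`IsEnergyFunction.drift_eq_self_iff`).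

The fairness process converges almost surely to the fixed point. A strong law of large numbers for
bounded martingale differences (`IsShieldedProcess.ae_tendsto_average`) shows that its value at time
`t` is, up to a null sequence, the average of the drifts at the times before `t`. A deterministic
argument (`tendsto_fixedPoint_of_sub_average`) turns this into convergence: the drift pulls towards
the fixed point from both sides.

Given the past, the next decision is flipped with probability `flipProb r p ζ κ m`, a continuous
function of `m`. By dominated convergence and Cesàro averaging, the expected cost converges to
`flipProb r p ζ κ μ`, where `μ` is the fixed point. There `|μ - d|` is the sum of the
probabilities of the unfavoured raw decisions in the two groups, times `ζ μ`, while the cost weighs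
the two probabilities by `r A, r B < 1` (`IsEnergyFunction.flipProb_lt`).
-/

namespace FairShield

/-! ### Averaging recursions with a decreasing drift -/

/-- If `x n` is asymptotic to the average of `F (x 0), …, F (x (n - 1))` for a continuous antitone
self-map `F` of an interval, then `x` converges to the fixed point of `F`. With `y n` the average,
`n * (y n - μ) ^ 2` grows in step `n` by at most a quantity that tends to zero, so that
`(y n - μ) ^ 2` is bounded by a Cesàro average of a null sequence. -/
theorem tendsto_fixedPoint_of_sub_average {F : ℝ → ℝ} {a b : ℝ}
    (hcont : ContinuousOn F (Set.Icc a b)) (hanti : AntitoneOn F (Set.Icc a b))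
    (hmaps : Set.MapsTo F (Set.Icc a b) (Set.Icc a b)) {μ : ℝ} (hμ : μ ∈ Set.Icc a b)
    (hfix : F μ = μ) {x : ℕ → ℝ} (hx : ∀ n, x n ∈ Set.Icc a b)
    (h : Tendsto (fun n : ℕ => x n - (∑ i ∈ Finset.range n, F (x i)) / n) atTop (𝓝 0)) :
    Tendsto x atTop (𝓝 μ) := by
  set y : ℕ → ℝ := fun n => (∑ i ∈ Finset.range n, F (x i)) / n with hy
  have hymem : ∀ n, 1 ≤ n → y n ∈ Set.Icc a b := by
    intro n hn
    have hn' : (0 : ℝ) < n := by exact_mod_cast hn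
    constructor
    · rw [hy, le_div_iff₀ hn']
      have := Finset.card_nsmul_le_sum (Finset.range n) (fun i => F (x i)) a
        fun i _ => (hmaps (hx i)).1
      simpa [mul_comm] using this
    · rw [hy, div_le_iff₀ hn']
      have := Finset.sum_le_card_nsmul (Finset.range n) (fun i => F (x i)) b
        fun i _ => (hmaps (hx i)).2
      simpa [mul_comm] using this
  have hbound : ∀ z ∈ Set.Icc a b, |z - μ| ≤ b - a := fun z hz => by
    rw [abs_le]; constructor <;> linarith [hz.1, hz.2, hμ.1, hμ.2]
  -- `F` is uniformly continuous and `x n - y n` tends to zero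
  have hFxy : Tendsto (fun n => F (x n) - F (y n)) atTop (𝓝 0) := by
    have huc := Metric.uniformContinuousOn_iff.1
      (isCompact_Icc.uniformContinuousOn_of_continuous hcont)
    rw [Metric.tendsto_atTop] at h ⊢
    intro ε hε
    obtain ⟨δ, hδ, hδε⟩ := huc ε hε
    obtain ⟨N, hN⟩ := h δ hδ
    refine ⟨max N 1, fun n hn => ?_⟩
    have h1 := hN n (le_trans (le_max_left _ _) hn)
    have h2 := hδε (x n) (hx n) (y n) (hymem n (le_trans (le_max_right _ _) hn))
      (by simpa [Real.dist_eq] using h1)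
    simpa [Real.dist_eq] using h2
  -- the bound for the increment of `n * (y n - μ) ^ 2` in step `n`
  set η : ℕ → ℝ := fun n =>
    2 * max 0 ((y n - μ) * (F (x n) - μ)) + (b - a) ^ 2 * (1 / ((n : ℝ) + 1))
    with hη
  have hη0 : Tendsto η atTop (𝓝 0) := by
    have h1 : Tendsto (fun n => max 0 ((y n - μ) * (F (x n) - μ))) atTop (𝓝 0) := by
      have h2 : Tendsto (fun n => (b - a) * |F (x n) - F (y n)|) atTop (𝓝 0) := by
        simpa using (hFxy.abs).const_mul (b - a)
      refine tendsto_of_tendsto_of_tendsto_of_le_of_le' tendsto_const_nhds h2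
        (Eventually.of_forall fun n => le_max_left _ _) ?_
      filter_upwards [eventually_ge_atTop 1] with n hn
      have hyn := hymem n hn
      have hab : 0 ≤ b - a := by linarith [hμ.1, hμ.2]
      refine max_le (by positivity) ?_
      -- antitonicity makes `F (y n) - μ` and `y n - μ` have opposite signs
      have hsign : (y n - μ) * (F (y n) - μ) ≤ 0 := by
        rcases le_total (y n) μ with hle | hle
        · have := hanti hyn hμ hle
          exact mul_nonpos_of_nonpos_of_nonneg (by linarith) (by linarith)
        · have := hanti hμ hyn hle
          exact mul_nonpos_of_nonneg_of_nonpos (by linarith) (by linarith)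
      calc (y n - μ) * (F (x n) - μ)
          = (y n - μ) * (F (y n) - μ) + (y n - μ) * (F (x n) - F (y n)) := by ring
        _ ≤ (y n - μ) * (F (x n) - F (y n)) := by linarith
        _ ≤ |y n - μ| * |F (x n) - F (y n)| := by rw [← abs_mul]; exact le_abs_self _
        _ ≤ _ := mul_le_mul_of_nonneg_right (hbound _ hyn) (abs_nonneg _)
    have h3 := (h1.const_mul 2).add
      ((tendsto_one_div_add_atTop_nhds_zero_nat (𝕜 := ℝ)).const_mul ((b - a) ^ 2))
    rwa [mul_zero, mul_zero, add_zero] at h3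
  have hstep : ∀ n : ℕ, (n : ℝ) * (y n - μ) ^ 2 ≤ ∑ i ∈ Finset.range n, η i := by
    intro n
    induction n with
    | zero => simp
    | succ n ih =>
      rw [Finset.sum_range_succ]
      have hn : (0 : ℝ) < (n : ℝ) + 1 := by positivity
      have hrec : ((n : ℝ) + 1) * (y (n + 1) - μ) = n * (y n - μ) + (F (x n) - μ) := by
        have h1 : ((n : ℝ) + 1) * y (n + 1) = n * y n + F (x n) := by
          simp only [hy, Finset.sum_range_succ]
          rcases Nat.eq_zero_or_pos n with rfl | hn0
          · simp
          · have : (n : ℝ) ≠ 0 := by positivity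
            push_cast
            field_simp
        linear_combination h1
      have he : (F (x n) - μ) ^ 2 ≤ (b - a) ^ 2 := by
        rw [← sq_abs]
        exact pow_le_pow_left₀ (abs_nonneg _) (hbound _ (hmaps (hx n))) 2
      have hmax0 := le_max_left 0 ((y n - μ) * (F (x n) - μ))
      have hmax := le_max_right 0 ((y n - μ) * (F (x n) - μ))
      have hηn : ((n : ℝ) + 1) * η n =
          2 * (n + 1) * max 0 ((y n - μ) * (F (x n) - μ)) + (b - a) ^ 2 := by
        simp only [hη]; field_simp
      have hnn : (0 : ℝ) ≤ n := by positivity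
      have key : ((n : ℝ) + 1) * (((n : ℝ) + 1) * (y (n + 1) - μ) ^ 2) ≤
          (n + 1) * (n * (y n - μ) ^ 2 + η n) := by
        calc ((n : ℝ) + 1) * (((n : ℝ) + 1) * (y (n + 1) - μ) ^ 2)
            = (((n : ℝ) + 1) * (y (n + 1) - μ)) ^ 2 := by ring
          _ = n ^ 2 * (y n - μ) ^ 2 + 2 * n * ((y n - μ) * (F (x n) - μ))
              + (F (x n) - μ) ^ 2 := by rw [hrec]; ring
          _ ≤ n ^ 2 * (y n - μ) ^ 2 + 2 * n * max 0 ((y n - μ) * (F (x n) - μ))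
              + (b - a) ^ 2 := by gcongr
          _ ≤ _ := by
            rw [mul_add, hηn]
            nlinarith [mul_nonneg hnn (sq_nonneg (y n - μ))]
      have := le_of_mul_le_mul_left key hn
      push_cast
      linarith
  have hv : Tendsto (fun n => (y n - μ) ^ 2) atTop (𝓝 0) := by
    have hc := hη0.cesaro
    refine tendsto_of_tendsto_of_tendsto_of_le_of_le' tendsto_const_nhds hc
      (Eventually.of_forall fun n => sq_nonneg _) ?_
    filter_upwards [eventually_ge_atTop 1] with n hn
    have hn' : (0 : ℝ) < n := by exact_mod_cast hn
    rw [inv_mul_eq_div, le_div_iff₀ hn', mul_comm]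
    exact hstep n
  have hu : Tendsto (fun n => y n - μ) atTop (𝓝 0) := by
    rw [tendsto_zero_iff_abs_tendsto_zero]
    have := hv.sqrt
    simpa [Real.sqrt_sq_eq_abs, Function.comp_def] using this
  have hsum := (h.add hu).add_const μ
  rw [zero_add, zero_add] at hsum
  exact hsum.congr fun n => by simp only [hy]; ring

/-! ### A strong law of large numbers -/

/-- A strong law of large numbers for bounded variables whose partial sums have second moments of
at most linear growth. These bounds make the averages along the squares square summable almost
surely, and boundedness controls the averages between consecutive squares. -/
theorem ae_tendsto_average_zero {Ω : Type*} [MeasurableSpace Ω] {P : Measure Ω}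
    {D : ℕ → Ω → ℝ} {C : ℝ} (hC : ∀ n ω, |D n ω| ≤ C)
    (hint : ∀ n, Integrable (fun ω => (∑ i ∈ Finset.range n, D i ω) ^ 2) P)
    (hsq : ∀ n : ℕ, ∫ ω, (∑ i ∈ Finset.range n, D i ω) ^ 2 ∂P ≤ n * C ^ 2) :
    ∀ᵐ ω ∂P, Tendsto (fun n : ℕ => (∑ i ∈ Finset.range n, D i ω) / n) atTop (𝓝 0) := by
  set f : ℕ → Ω → ℝ := fun k ω => ((∑ i ∈ Finset.range (k ^ 2), D i ω) / (k : ℝ) ^ 2) ^ 2 with hf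
  have hfint : ∀ k, Integrable (f k) P := by
    intro k
    simp only [hf, div_pow]
    exact (hint _).div_const _
  have hfsq : ∀ k, ∫ ω, f k ω ∂P ≤ C ^ 2 * (1 / (k : ℝ) ^ 2) := by
    intro k
    simp only [hf, div_pow]
    rw [integral_div]
    have := hsq (k ^ 2)
    rcases Nat.eq_zero_or_pos k with rfl | hk
    · simp
    have hk' : (0 : ℝ) < k := by exact_mod_cast hk
    rw [div_le_iff₀ (by positivity)]
    push_cast at this
    refine this.trans (le_of_eq ?_)
    field_simp
  have hfin : ∫⁻ ω, ∑' k, ENNReal.ofReal (f k ω) ∂P ≠ ⊤ := by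
    rw [lintegral_tsum fun k => (hfint k).aemeasurable.ennreal_ofReal]
    have hsum : Summable fun k : ℕ => ∫ ω, f k ω ∂P :=
      Summable.of_nonneg_of_le (fun k => integral_nonneg fun ω => sq_nonneg _) hfsq
        ((Real.summable_one_div_nat_pow.2 one_lt_two).mul_left _)
    have : ∀ k, ∫⁻ ω, ENNReal.ofReal (f k ω) ∂P = ENNReal.ofReal (∫ ω, f k ω ∂P) := fun k =>
      (ofReal_integral_eq_lintegral_ofReal (hfint k)
        (Eventually.of_forall fun ω => sq_nonneg _)).symm
    simp_rw [this]
    exact hsum.tsum_ofReal_ne_top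
  have hae := ae_lt_top' (AEMeasurable.tsum
    fun k => (hfint k).aemeasurable.ennreal_ofReal) hfin
  filter_upwards [hae] with ω hω
  have hsub : Tendsto (fun k : ℕ => |(∑ i ∈ Finset.range (k ^ 2), D i ω) / (k : ℝ) ^ 2|)
      atTop (𝓝 0) := by
    have h1 : Tendsto (fun k => f k ω) atTop (𝓝 0) := by
      have h2 := ENNReal.tendsto_atTop_zero_of_tsum_ne_top hω.ne
      have h3 := (ENNReal.tendsto_toReal ENNReal.zero_ne_top).comp h2
      simpa [Function.comp_def, hf, ENNReal.toReal_ofReal, sq_nonneg] using h3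
    simpa [hf, Real.sqrt_sq_eq_abs] using h1.sqrt
  -- the average at time `n` is compared with that at the largest square up to `n`
  have hsqrt : Tendsto Nat.sqrt atTop atTop :=
    tendsto_atTop_mono' _ (Eventually.of_forall fun _ => le_rfl)
      (tendsto_atTop_atTop.2 fun b => ⟨b ^ 2, fun a ha => Nat.le_sqrt'.2 ha⟩)
  have hlim : Tendsto (fun n : ℕ =>
      |(∑ i ∈ Finset.range (n.sqrt ^ 2), D i ω) / (n.sqrt : ℝ) ^ 2| + 2 * C / (n.sqrt : ℝ))
      atTop (𝓝 0) := by
    have := (hsub.add (tendsto_const_div_atTop_nhds_zero_nat (2 * C))).comp hsqrt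
    simpa [Function.comp_def] using this
  rw [tendsto_zero_iff_abs_tendsto_zero]
  refine tendsto_of_tendsto_of_tendsto_of_le_of_le' tendsto_const_nhds hlim
    (Eventually.of_forall fun n => abs_nonneg _) ?_
  filter_upwards [eventually_ge_atTop 1] with n hn
  have hC0 : 0 ≤ C := (abs_nonneg _).trans (hC 0 ω)
  set k := n.sqrt with hk
  have hk1 : 1 ≤ k := Nat.le_sqrt.2 (by simpa using hn)
  have hk0 : (0 : ℝ) < k := by exact_mod_cast hk1
  have hkn : k ^ 2 ≤ n := Nat.sqrt_le' n
  have hnk : n ≤ k * k + k + k := Nat.sqrt_le_add n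
  have hn0 : (0 : ℝ) < n := by exact_mod_cast hn
  have hkn' : (k : ℝ) ^ 2 ≤ n := by exact_mod_cast hkn
  have htail : |∑ i ∈ Finset.Ico (k ^ 2) n, D i ω| ≤ 2 * k * C := by
    calc |∑ i ∈ Finset.Ico (k ^ 2) n, D i ω| ≤ ∑ i ∈ Finset.Ico (k ^ 2) n, |D i ω| :=
          Finset.abs_sum_le_sum_abs _ _
      _ ≤ (Finset.Ico (k ^ 2) n).card • C := Finset.sum_le_card_nsmul _ _ _ fun i _ => hC i ω
      _ = ((n - k ^ 2 : ℕ) : ℝ) * C := by simp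
      _ ≤ ((2 * k : ℕ) : ℝ) * C := by
          gcongr
          rw [sq]; omega
      _ = 2 * k * C := by push_cast; ring
  rw [Function.comp_apply, abs_div, abs_of_pos hn0, ← Finset.sum_range_add_sum_Ico _ hkn]
  calc |∑ i ∈ Finset.range (k ^ 2), D i ω + ∑ i ∈ Finset.Ico (k ^ 2) n, D i ω| / n
      ≤ (|∑ i ∈ Finset.range (k ^ 2), D i ω| + 2 * k * C) / n := by
        gcongr
        exact (abs_add_le _ _).trans (by gcongr)
    _ ≤ (|∑ i ∈ Finset.range (k ^ 2), D i ω| + 2 * k * C) / (k : ℝ) ^ 2 := by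
        gcongr
    _ = _ := by
        rw [abs_div, abs_of_pos (show (0 : ℝ) < (k : ℝ) ^ 2 by positivity)]
        field_simp

/-! ### Expectations along the process -/

instance : Fintype Demographic := ⟨{.A, .B}, fun g => by cases g <;> simp⟩

theorem sum_demographic (f : Demographic → ℝ) : ∑ g, f g = f .A + f .B :=
  Finset.sum_pair (by decide)

/-- The probability of the step `s` after the history `h`, under the shield `S`. -/
noncomputable def stepMass (r p : Demographic → ℝ) (S : Shield) (h : List Step) (s : Step) : ℝ :=
  r s.1 * bernoulliMass (p s.1) s.2.1 * bernoulliMass (S h s.1 s.2.1) s.2.2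

/-- Integrals of functions of a random element with finitely many values are finite sums. No
measurable structure on the type of values is involved. -/
theorem integrable_and_integral_comp_of_finite_range {Ω α : Type*} [MeasurableSpace Ω]
    {P : Measure Ω} [IsFiniteMeasure P] {W : Ω → α} (hW : ∀ a, MeasurableSet {ω | W ω = a})
    (L : Finset α) (hL : ∀ ω, W ω ∈ L) (f : α → ℝ) :
    Integrable (fun ω => f (W ω)) P ∧
      ∫ ω, f (W ω) ∂P = ∑ a ∈ L, P.real {ω | W ω = a} * f a := by
  classical
  have hrep : (fun ω => f (W ω)) =
      fun ω => ∑ a ∈ L, Set.indicator {ω | W ω = a} (fun _ => f a) ω := by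
    funext ω
    rw [Finset.sum_eq_single_of_mem (W ω) (hL ω)]
    · simp
    · intro a _ ha
      simp [ha.symm]
  have hint : ∀ a ∈ L, Integrable (Set.indicator {ω | W ω = a} (fun _ => f a)) P :=
    fun a _ => (integrable_const _).indicator (hW a)
  rw [hrep]
  refine ⟨integrable_finsetSum L hint, ?_⟩
  rw [integral_finsetSum L hint]
  exact Finset.sum_congr rfl fun a _ => by rw [integral_indicator_const _ (hW a), smul_eq_mul]

section

variable {Ω : Type*} {G : ℕ → Ω → Demographic} {X Y : ℕ → Ω → Bool}

theorem history_succ (t : ℕ) (ω : Ω) :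
    history G X Y (t + 1) ω = history G X Y t ω ++ [(G t ω, X t ω, Y t ω)] := by
  simp [history, List.range_succ]

theorem history_mem (t : ℕ) (ω : Ω) :
    history G X Y t ω ∈ (List.finite_length_eq Step t).toFinset := by
  simp [history]

/-- A sum over the past steps is a function of the history, as a history determines its initial
segments. -/
theorem exists_sum_eq_comp_history (Φ : List Step → Step → ℝ) (n : ℕ) :
    ∃ φ : List Step → ℝ, ∀ ω : Ω,
      ∑ i ∈ Finset.range n, Φ (history G X Y i ω) (G i ω, X i ω, Y i ω) =
        φ (history G X Y n ω) := by
  induction n with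
  | zero => exact ⟨fun _ => 0, fun ω => by simp⟩
  | succ n ih =>
    obtain ⟨φ, hφ⟩ := ih
    -- the default value is irrelevant, as a history of length `n + 1` has a last step
    refine ⟨fun l => φ l.dropLast + Φ l.dropLast (l.getLast?.getD (.A, true, true)), fun ω => ?_⟩
    rw [Finset.sum_range_succ, hφ, history_succ]
    simp

variable [MeasurableSpace Ω] {P : Measure Ω} {r p : Demographic → ℝ} {S : Shield}

theorem IsShieldedProcess.measurableSet_step_eq (h : IsShieldedProcess G X Y P r p S) (t : ℕ)
    (s : Step) : MeasurableSet {ω | (G t ω, X t ω, Y t ω) = s} := by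
  have h1 : MeasurableSet {ω | G t ω = s.1} :=
    h.measurable_group t (show MeasurableSet {s.1} from trivial)
  have h2 := h.measurable_decision t (measurableSet_singleton s.2.1)
  have h3 := h.measurable_intervention t (measurableSet_singleton s.2.2)
  convert h1.inter (h2.inter h3) using 1
  ext ω
  simp [Prod.ext_iff]

theorem IsShieldedProcess.measurableSet_history_eq (h : IsShieldedProcess G X Y P r p S) (t : ℕ)
    (l : List Step) : MeasurableSet {ω | history G X Y t ω = l} := by
  induction t generalizing l with
  | zero => simp [history]
  | succ t ih =>
    rcases List.eq_nil_or_concat l with rfl | ⟨l, s, rfl⟩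
    · simp [history_succ]
    · convert (ih l).inter (h.measurableSet_step_eq t s) using 1
      ext ω
      simp only [history_succ, List.concat_eq_append, Set.mem_ofPred_eq, Set.mem_inter_iff]
      rw [← List.concat_eq_append, ← List.concat_eq_append, List.concat_inj]

variable [IsProbabilityMeasure P]

theorem IsShieldedProcess.integrable_comp_history (h : IsShieldedProcess G X Y P r p S) (t : ℕ)
    (f : List Step → ℝ) : Integrable (fun ω => f (history G X Y t ω)) P :=
  (integrable_and_integral_comp_of_finite_range (h.measurableSet_history_eq t) _
    (history_mem t) f).1

/-- The law of total expectation for one step: conditionally on the history, the next step has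
the mass function `stepMass`. -/
theorem IsShieldedProcess.integrable_and_integral_step (h : IsShieldedProcess G X Y P r p S) (t : ℕ)
    (Φ : List Step → Step → ℝ) :
    Integrable (fun ω => Φ (history G X Y t ω) (G t ω, X t ω, Y t ω)) P ∧
      ∫ ω, Φ (history G X Y t ω) (G t ω, X t ω, Y t ω) ∂P =
        ∫ ω, ∑ s, stepMass r p S (history G X Y t ω) s * Φ (history G X Y t ω) s ∂P := by
  have hmeas : ∀ a : List Step × Step,
      MeasurableSet {ω | (history G X Y t ω, (G t ω, X t ω, Y t ω)) = a} := by
    intro a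
    convert (h.measurableSet_history_eq t a.1).inter (h.measurableSet_step_eq t a.2) using 1
    ext ω
    simp [Prod.ext_iff]
  obtain ⟨h1, h2⟩ := integrable_and_integral_comp_of_finite_range (P := P) hmeas
    ((List.finite_length_eq Step t).toFinset ×ˢ Finset.univ)
    (fun ω => Finset.mem_product.2 ⟨history_mem t ω, Finset.mem_univ _⟩)
    (fun a => Φ a.1 a.2)
  refine ⟨h1, h2.trans ?_⟩
  rw [(integrable_and_integral_comp_of_finite_range (P := P) (h.measurableSet_history_eq t) _
    (history_mem t) fun l => ∑ s, stepMass r p S l s * Φ l s).2, Finset.sum_product]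
  refine Finset.sum_congr rfl fun l _ => ?_
  rw [Finset.mul_sum]
  refine Finset.sum_congr rfl fun s _ => ?_
  have := h.law t l s.1 s.2.1 s.2.2
  rw [← mul_assoc, stepMass, ← this]
  congr 3
  ext ω
  simp [Prod.ext_iff]

/-- The second moment of a sum of bounded martingale differences grows at most linearly: each new
term is orthogonal to the past sum. -/
theorem IsShieldedProcess.integral_sq_sum_le (h : IsShieldedProcess G X Y P r p S)
    {Φ : List Step → Step → ℝ} {C : ℝ} (hC : ∀ l s, |Φ l s| ≤ C)
    (hΦ : ∀ l, ∑ s, stepMass r p S l s * Φ l s = 0) (n : ℕ) :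
    ∫ ω, (∑ i ∈ Finset.range n, Φ (history G X Y i ω) (G i ω, X i ω, Y i ω)) ^ 2 ∂P ≤
      n * C ^ 2 := by
  induction n with
  | zero => simp
  | succ n ih =>
    obtain ⟨φ, hφ⟩ := exists_sum_eq_comp_history (G := G) (X := X) (Y := Y) Φ n
    simp_rw [Finset.sum_range_succ, hφ] at ih ⊢
    have hcross := h.integrable_and_integral_step n fun l s => φ l * Φ l s
    have hzero : ∫ ω, φ (history G X Y n ω) *
        Φ (history G X Y n ω) (G n ω, X n ω, Y n ω) ∂P = 0 := by
      rw [hcross.2]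
      simp_rw [mul_left_comm _ (φ _), ← Finset.mul_sum, hΦ]
      simp
    have hi1 : Integrable (fun ω => φ (history G X Y n ω) ^ 2) P :=
      h.integrable_comp_history n fun l => φ l ^ 2
    calc ∫ ω, (φ (history G X Y n ω) + Φ (history G X Y n ω) (G n ω, X n ω, Y n ω)) ^ 2 ∂P
        ≤ ∫ ω, (φ (history G X Y n ω) ^ 2 + 2 * (φ (history G X Y n ω) *
            Φ (history G X Y n ω) (G n ω, X n ω, Y n ω)) + C ^ 2) ∂P := by
          refine integral_mono (h.integrable_and_integral_step n fun l s => (φ l + Φ l s) ^ 2).1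
            ((hi1.add (hcross.1.const_mul 2)).add (integrable_const _)) fun ω => ?_
          have := sq_le_sq' (neg_le_of_abs_le (hC (history G X Y n ω) (G n ω, X n ω, Y n ω)))
            (le_of_abs_le (hC _ _))
          simp only
          linarith
      _ = ∫ ω, φ (history G X Y n ω) ^ 2 ∂P + C ^ 2 := by
          have hi2 := hcross.1.const_mul 2
          have hi3 := integral_add (hi1.add hi2) (integrable_const (C ^ 2))
          simp only [Pi.add_apply] at hi3
          rw [hi3, integral_add hi1 hi2, integral_const_mul, hzero]
          simp
      _ ≤ _ := by push_cast; linarith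

end

/-! ### Acceptance rates of a history -/

theorem rateDifference_mem_Icc (w : List (Demographic × Bool)) :
    rateDifference w ∈ Set.Icc (-1 : ℝ) 1 := by
  have h : ∀ g, acceptanceRate w g ∈ Set.Icc (0 : ℝ) 1 := fun g => by
    refine ⟨by unfold acceptanceRate; positivity, div_le_one_of_le₀ ?_ (by positivity)⟩
    have := List.count_le_count_map (l := w) (f := Prod.fst) (x := (g, true))
    exact_mod_cast this
  constructor <;> simp only [rateDifference] <;>
    linarith [(h .A).1, (h .A).2, (h .B).1, (h .B).2]

theorem count_group_history {Ω : Type*} (G : ℕ → Ω → Demographic) (X Y : ℕ → Ω → Bool) (t : ℕ)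
    (ω : Ω) (g : Demographic) :
    (((releasedHistory (history G X Y t ω)).map Prod.fst).count g : ℝ) =
      ∑ i ∈ Finset.range t, if G i ω = g then (1 : ℝ) else 0 := by
  induction t with
  | zero => simp [history, releasedHistory]
  | succ t ih =>
    rw [history_succ, Finset.sum_range_succ, ← ih]
    simp [releasedHistory, List.count_singleton]

theorem count_accepted_history {Ω : Type*} (G : ℕ → Ω → Demographic) (X Y : ℕ → Ω → Bool) (t : ℕ)
    (ω : Ω) (g : Demographic) :
    ((releasedHistory (history G X Y t ω)).count (g, true) : ℝ) =
      ∑ i ∈ Finset.range t, if G i ω = g ∧ released (X i ω) (Y i ω) then (1 : ℝ) else 0 := by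
  induction t with
  | zero => simp [history, releasedHistory]
  | succ t ih =>
    rw [history_succ, Finset.sum_range_succ, ← ih]
    simp [releasedHistory, List.count_singleton]

/-! ### The drift and the cost of the energy shield -/

section Energy

variable {ζ : ℝ → ℝ} {κ : ℝ}

/-- The conditional probability that the next member of group `g` is accepted, when the rate
difference is `m`. -/
noncomputable def acceptProb (p : Demographic → ℝ) (ζ : ℝ → ℝ) (κ m : ℝ) (g : Demographic) : ℝ :=
  if favoured κ m g then p g + (1 - p g) * ζ m else p g * (1 - ζ m)

/-- The difference between the conditional acceptance probabilities of the two groups, when the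
rate difference is `m`. As `ζ` vanishes at `κ`, only one of the two values of `ζ` is non-zero:
that at `m`. -/
def drift (ζ : ℝ → ℝ) (κ d m : ℝ) : ℝ :=
  d + (1 - d) * ζ (min m κ) - (1 + d) * ζ (max m κ)

/-- The conditional probability that the next decision is flipped, when the rate difference
is `m`. As in `drift`, only the value of `ζ` at `m` can be non-zero. -/
def flipProb (r p : Demographic → ℝ) (ζ : ℝ → ℝ) (κ m : ℝ) : ℝ :=
  (r .A * (1 - p .A) + r .B * p .B) * ζ (min m κ) +
    (r .A * p .A + r .B * (1 - p .B)) * ζ (max m κ)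

theorem IsEnergyFunction.antitoneOn (hζ : IsEnergyFunction ζ κ) :
    AntitoneOn ζ (Set.Icc (-1) κ) := by
  have hsub : Set.Icc (-1) κ ⊆ Set.Icc (-1 : ℝ) 1 := Set.Icc_subset_Icc_right hζ.pivot_mem.2
  refine antitoneOn_of_deriv_nonpos (convex_Icc _ _) (hζ.differentiable.continuousOn.mono hsub)
    (hζ.differentiable.mono (interior_subset.trans hsub)) fun x hx => ?_
  rw [interior_Icc] at hx
  have hx1 : x < 1 := hx.2.trans_le hζ.pivot_mem.2
  rw [← derivWithin_of_mem_nhds (Icc_mem_nhds hx.1 hx1)]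
  exact hζ.deriv_nonpos x ⟨hx.1.le, hx1.le⟩ hx.2

theorem IsEnergyFunction.monotoneOn (hζ : IsEnergyFunction ζ κ) :
    MonotoneOn ζ (Set.Icc κ 1) := by
  have hsub : Set.Icc κ 1 ⊆ Set.Icc (-1 : ℝ) 1 := Set.Icc_subset_Icc_left hζ.pivot_mem.1
  refine monotoneOn_of_deriv_nonneg (convex_Icc _ _) (hζ.differentiable.continuousOn.mono hsub)
    (hζ.differentiable.mono (interior_subset.trans hsub)) fun x hx => ?_
  rw [interior_Icc] at hx
  have hx1 : -1 < x := hζ.pivot_mem.1.trans_lt hx.1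
  rw [← derivWithin_of_mem_nhds (Icc_mem_nhds hx1 hx.2)]
  exact hζ.deriv_nonneg x ⟨hx1.le, hx.2.le⟩ hx.1

theorem IsEnergyFunction.continuousOn_comp_min (hζ : IsEnergyFunction ζ κ) :
    ContinuousOn (fun m => ζ (min m κ)) (Set.Icc (-1) 1) :=
  hζ.differentiable.continuousOn.comp (by fun_prop)
    fun _ hm => ⟨le_min hm.1 hζ.pivot_mem.1, (min_le_left _ _).trans hm.2⟩

theorem IsEnergyFunction.continuousOn_comp_max (hζ : IsEnergyFunction ζ κ) :
    ContinuousOn (fun m => ζ (max m κ)) (Set.Icc (-1) 1) :=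
  hζ.differentiable.continuousOn.comp (by fun_prop)
    fun _ hm => ⟨hm.1.trans (le_max_left _ _), max_le hm.2 hζ.pivot_mem.2⟩

theorem IsEnergyFunction.continuousOn_drift (hζ : IsEnergyFunction ζ κ) (d : ℝ) :
    ContinuousOn (drift ζ κ d) (Set.Icc (-1) 1) :=
  (continuousOn_const.add (continuousOn_const.mul hζ.continuousOn_comp_min)).sub
    (continuousOn_const.mul hζ.continuousOn_comp_max)

theorem IsEnergyFunction.continuousOn_flipProb (hζ : IsEnergyFunction ζ κ)
    (r p : Demographic → ℝ) : ContinuousOn (flipProb r p ζ κ) (Set.Icc (-1) 1) :=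
  (continuousOn_const.mul hζ.continuousOn_comp_min).add
    (continuousOn_const.mul hζ.continuousOn_comp_max)

theorem drift_of_le (h0 : ζ κ = 0) (d : ℝ) {m : ℝ} (hm : m ≤ κ) :
    drift ζ κ d m = d + (1 - d) * ζ m := by
  simp [drift, hm, h0]

theorem drift_of_ge (h0 : ζ κ = 0) (d : ℝ) {m : ℝ} (hm : κ ≤ m) :
    drift ζ κ d m = d - (1 + d) * ζ m := by
  simp [drift, hm, h0]

theorem acceptProb_sub (h0 : ζ κ = 0) (p : Demographic → ℝ) (m : ℝ) :
    acceptProb p ζ κ m .A - acceptProb p ζ κ m .B = drift ζ κ (p .A - p .B) m := by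
  rcases le_or_gt m κ with hm | hm
  · rw [drift_of_le h0 _ hm]
    simp [acceptProb, favoured, hm, hm.not_gt]
    ring
  · rw [drift_of_ge h0 _ hm.le]
    simp [acceptProb, favoured, hm, hm.not_ge]
    ring

variable {d : ℝ}

theorem IsEnergyFunction.antitoneOn_drift (hζ : IsEnergyFunction ζ κ)
    (hd : d ∈ Set.Icc (-1 : ℝ) 1) : AntitoneOn (drift ζ κ d) (Set.Icc (-1) 1) := by
  intro a ha b hb hab
  have h1 : ζ (min b κ) ≤ ζ (min a κ) := hζ.antitoneOn
    ⟨le_min ha.1 hζ.pivot_mem.1, min_le_right _ _⟩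
    ⟨le_min hb.1 hζ.pivot_mem.1, min_le_right _ _⟩ (min_le_min_right _ hab)
  have h2 : ζ (max a κ) ≤ ζ (max b κ) := hζ.monotoneOn
    ⟨le_max_right _ _, max_le ha.2 hζ.pivot_mem.2⟩
    ⟨le_max_right _ _, max_le hb.2 hζ.pivot_mem.2⟩ (max_le_max_right _ hab)
  have h3 := mul_le_mul_of_nonneg_left h1 (show 0 ≤ 1 - d by linarith [hd.2])
  have h4 := mul_le_mul_of_nonneg_left h2 (show 0 ≤ 1 + d by linarith [hd.1])
  unfold drift
  linarith

theorem IsEnergyFunction.mapsTo_drift (hζ : IsEnergyFunction ζ κ)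
    (hd : d ∈ Set.Icc (-1 : ℝ) 1) :
    Set.MapsTo (drift ζ κ d) (Set.Icc (-1) 1) (Set.Icc (-1) 1) := by
  intro m hm
  obtain ⟨h1, h2⟩ := hζ.maps_to m hm
  obtain ⟨h3, h4⟩ := hd
  rcases le_total m κ with h | h
  · rw [drift_of_le hζ.pivot_eq_zero _ h]
    constructor <;> nlinarith
  · rw [drift_of_ge hζ.pivot_eq_zero _ h]
    constructor <;> nlinarith

/-- The fixed points of the drift are the points that satisfy the criterion of the theorem. The
sign of `drift ζ κ d m - d` depends on the side of `κ` on which `m` lies, which forces a fixed point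
to lie between `d` and `κ`. -/
theorem IsEnergyFunction.drift_eq_self_iff (hζ : IsEnergyFunction ζ κ)
    (hd : d ∈ Set.Ioo (-1 : ℝ) 1) {μ : ℝ} (hμ : μ ∈ Set.Icc (-1 : ℝ) 1) :
    drift ζ κ d μ = μ ↔
      μ ∈ Set.uIcc d κ ∧ ζ μ = if d < μ then (μ - d) / (1 - d) else (d - μ) / (1 + d) := by
  have h1 : 0 < 1 - d := by linarith [hd.2]
  have h2 : 0 < 1 + d := by linarith [hd.1]
  have hpos := (hζ.maps_to μ hμ).1
  have h0 := hζ.pivot_eq_zero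
  rw [Set.mem_uIcc]
  constructor
  · intro hfix
    rcases le_total μ κ with h | h
    · rw [drift_of_le h0 _ h] at hfix
      have hdμ : d ≤ μ := by nlinarith
      refine ⟨Or.inl ⟨hdμ, h⟩, ?_⟩
      rcases hdμ.lt_or_eq with hlt | rfl
      · rw [if_pos hlt, eq_div_iff h1.ne']
        linarith
      · simpa [h1.ne'] using hfix
    · rw [drift_of_ge h0 _ h] at hfix
      have hdμ : μ ≤ d := by nlinarith
      refine ⟨Or.inr ⟨h, hdμ⟩, ?_⟩
      rw [if_neg hdμ.not_gt, eq_div_iff h2.ne']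
      linarith
  · rintro ⟨hmem, hval⟩
    split_ifs at hval with hlt
    · rw [eq_div_iff h1.ne'] at hval
      have hμκ : μ ≤ κ := by
        rcases hmem with h | h <;> linarith
      rw [drift_of_le h0 _ hμκ]
      linarith
    · rw [eq_div_iff h2.ne'] at hval
      rcases hmem with h | h
      · obtain rfl : d = μ := le_antisymm h.1 (not_lt.1 hlt)
        have : ζ d = 0 := by
          have : ζ d * (1 + d) = 0 := by linarith
          exact (mul_eq_zero.1 this).resolve_right h2.ne'
        rw [drift_of_le h0 _ h.2, this]
        simp
      · rw [drift_of_ge h0 _ h.1]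
        linarith

variable {r p : Demographic → ℝ}

/-- At a fixed point of the drift other than `d`, the distance to `d` is the sum of the
probabilities of the unfavoured raw decisions in both groups, times `ζ μ`; the cost is the same
sum with the weights `r g < 1`. -/
theorem IsEnergyFunction.flipProb_lt (hζ : IsEnergyFunction ζ κ)
    (hr : ∀ g, r g ∈ Set.Ioo (0 : ℝ) 1) (hp : ∀ g, p g ∈ Set.Ioo (0 : ℝ) 1) {μ : ℝ}
    (hμ : μ ∈ Set.Icc (-1 : ℝ) 1) (hfix : drift ζ κ (p .A - p .B) μ = μ)
    (hne : μ ≠ p .A - p .B) : flipProb r p ζ κ μ < |μ - (p .A - p .B)| := by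
  have h0 := hζ.pivot_eq_zero
  have hz := (hζ.maps_to μ hμ).1
  have hmul : ∀ g, ∀ q, 0 < q → r g * q < q := fun g q hq => mul_lt_of_lt_one_left hq (hr g).2
  have hp' : ∀ g, 0 < 1 - p g := fun g => by linarith [(hp g).2]
  have hzpos : 0 < ζ μ := by
    refine hz.lt_of_ne' fun hz0 => hne ?_
    rcases le_total μ κ with h | h
    · rw [← hfix, drift_of_le h0 _ h, hz0]; ring
    · rw [← hfix, drift_of_ge h0 _ h, hz0]; ring
  rcases le_total μ κ with h | h
  · rw [drift_of_le h0 _ h] at hfix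
    calc flipProb r p ζ κ μ = (r .A * (1 - p .A) + r .B * p .B) * ζ μ := by
          simp [flipProb, h, h0]
      _ < ((1 - p .A) + p .B) * ζ μ := mul_lt_mul_of_pos_right
          (add_lt_add (hmul _ _ (hp' _)) (hmul _ _ (hp _).1)) hzpos
      _ = μ - (p .A - p .B) := by linarith
      _ ≤ _ := le_abs_self _
  · rw [drift_of_ge h0 _ h] at hfix
    calc flipProb r p ζ κ μ = (r .A * p .A + r .B * (1 - p .B)) * ζ μ := by
          simp [flipProb, h, h0]
      _ < (p .A + (1 - p .B)) * ζ μ := mul_lt_mul_of_pos_right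
          (add_lt_add (hmul _ _ (hp _).1) (hmul _ _ (hp' _))) hzpos
      _ = -(μ - (p .A - p .B)) := by linarith
      _ ≤ _ := neg_le_abs _

theorem IsEnergyFunction.flipProb_eq_zero (hζ : IsEnergyFunction ζ κ)
    (hd : d ∈ Set.Ioo (-1 : ℝ) 1) (hfix : drift ζ κ d d = d) : flipProb r p ζ κ d = 0 := by
  have h0 := hζ.pivot_eq_zero
  have h1 : 1 - d ≠ 0 := by linarith [hd.2]
  have h2 : 1 + d ≠ 0 := by linarith [hd.1]
  have hz : ζ d = 0 := by
    rcases le_total d κ with h | h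
    · simpa [drift_of_le h0 _ h, h1] using hfix
    · simpa [drift_of_ge h0 _ h, h2] using hfix
  rcases le_total d κ with h | h <;> simp [flipProb, h, h0, hz]

theorem sum_stepMass (hr_sum : r .A + r .B = 1) (S : Shield) (l : List Step) :
    ∑ s, stepMass r p S l s = 1 := by
  simp only [Fintype.sum_prod_type, sum_demographic, Fintype.sum_bool, stepMass, bernoulliMass]
  simp
  linear_combination hr_sum

theorem sum_stepMass_mul_group (S : Shield) (l : List Step) (g : Demographic) :
    ∑ s, stepMass r p S l s * (if s.1 = g then 1 else 0) = r g := by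
  simp only [Fintype.sum_prod_type, sum_demographic, Fintype.sum_bool, stepMass, bernoulliMass]
  cases g <;> simp <;> ring

theorem sum_stepMass_mul_released (l : List Step) (g : Demographic) :
    ∑ s, stepMass r p (energyShield ζ κ) l s *
        (if s.1 = g ∧ released s.2.1 s.2.2 then 1 else 0) =
      r g * acceptProb p ζ κ (rateDifference (releasedHistory l)) g := by
  simp only [Fintype.sum_prod_type, sum_demographic, Fintype.sum_bool, stepMass, bernoulliMass,
    energyShield, acceptProb]
  cases h : favoured κ (rateDifference (releasedHistory l)) g <;> cases g <;>
    simp [released, h] <;> ring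

theorem sum_stepMass_mul_flip (h0 : ζ κ = 0) (l : List Step) :
    ∑ s, stepMass r p (energyShield ζ κ) l s * (if s.2.2 then 1 else 0) =
      flipProb r p ζ κ (rateDifference (releasedHistory l)) := by
  simp only [Fintype.sum_prod_type, sum_demographic, Fintype.sum_bool, stepMass, bernoulliMass,
    energyShield, flipProb, favoured]
  rcases le_or_gt (rateDifference (releasedHistory l)) κ with h | h
  · simp [h, h.not_gt, h0]
    ring
  · simp [h, h.le, h.not_ge, h0]
    ring

end Energy

/-! ### Convergence of the fairness process and of the expected cost -/

section Convergence

variable {Ω : Type*} [MeasurableSpace Ω] {P : Measure Ω} [IsProbabilityMeasure P]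
  {r p : Demographic → ℝ} {G : ℕ → Ω → Demographic} {X Y : ℕ → Ω → Bool}

/-- The strong law of large numbers for bounded functions of the steps that are conditionally
centred given the history. -/
theorem IsShieldedProcess.ae_tendsto_average {S : Shield} (h : IsShieldedProcess G X Y P r p S)
    {Φ : List Step → Step → ℝ} {C : ℝ} (hC : ∀ l s, |Φ l s| ≤ C)
    (hΦ : ∀ l, ∑ s, stepMass r p S l s * Φ l s = 0) :
    ∀ᵐ ω ∂P, Tendsto (fun n : ℕ =>
      (∑ i ∈ Finset.range n, Φ (history G X Y i ω) (G i ω, X i ω, Y i ω)) / n) atTop (𝓝 0) := by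
  refine ae_tendsto_average_zero (fun n ω => hC _ _) (fun n => ?_) (h.integral_sq_sum_le hC hΦ)
  obtain ⟨φ, hφ⟩ := exists_sum_eq_comp_history (G := G) (X := X) (Y := Y) Φ n
  simp_rw [hφ]
  exact h.integrable_comp_history n fun l => φ l ^ 2

variable {ζ : ℝ → ℝ} {κ : ℝ}

theorem IsEnergyFunction.acceptProb_mem_Icc (hζ : IsEnergyFunction ζ κ)
    (hp : ∀ g, p g ∈ Set.Ioo (0 : ℝ) 1) {m : ℝ} (hm : m ∈ Set.Icc (-1 : ℝ) 1)
    (g : Demographic) : acceptProb p ζ κ m g ∈ Set.Icc (0 : ℝ) 1 := by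
  obtain ⟨h1, h2⟩ := hζ.maps_to m hm
  obtain ⟨h3, h4⟩ := hp g
  unfold acceptProb
  split_ifs <;> constructor <;> nlinarith

/-- The acceptance rate of each group is asymptotic to the average of its past conditional
acceptance probabilities. Both the number of members of the group and the number of its accepted
members obey the strong law, and dividing one by the other cancels the factor `r g`. -/
theorem IsShieldedProcess.ae_tendsto_acceptanceRate_sub
    (h : IsShieldedProcess G X Y P r p (energyShield ζ κ)) (hζ : IsEnergyFunction ζ κ)
    (hr : ∀ g, r g ∈ Set.Ioo (0 : ℝ) 1) (hr_sum : r .A + r .B = 1)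
    (hp : ∀ g, p g ∈ Set.Ioo (0 : ℝ) 1) (g : Demographic) :
    ∀ᵐ ω ∂P, Tendsto (fun t : ℕ => acceptanceRate (releasedHistory (history G X Y t ω)) g -
      (∑ i ∈ Finset.range t, acceptProb p ζ κ (fairness G X Y i ω) g) / t) atTop (𝓝 0) := by
  have hab : ∀ (b : Prop) [Decidable b] {q : ℝ}, q ∈ Set.Icc (0 : ℝ) 1 →
      |(if b then (1 : ℝ) else 0) - q| ≤ 1 := by
    intro b _ q hq
    rw [abs_le]
    split_ifs <;> constructor <;> linarith [hq.1, hq.2]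
  have hq : ∀ l, acceptProb p ζ κ (rateDifference (releasedHistory l)) g ∈ Set.Icc (0 : ℝ) 1 :=
    fun l => hζ.acceptProb_mem_Icc hp (rateDifference_mem_Icc _) g
  have hN := h.ae_tendsto_average (Φ := fun _ s => (if s.1 = g then 1 else 0) - r g)
    (fun l s => hab _ ⟨(hr g).1.le, (hr g).2.le⟩) fun l => by
      simp_rw [mul_sub, Finset.sum_sub_distrib, ← Finset.sum_mul, sum_stepMass hr_sum,
        sum_stepMass_mul_group]
      ring
  have hS := h.ae_tendsto_average (Φ := fun l s =>
      (if s.1 = g ∧ released s.2.1 s.2.2 then 1 else 0) -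
        r g * acceptProb p ζ κ (rateDifference (releasedHistory l)) g)
    (fun l s => hab _ ⟨mul_nonneg (hr g).1.le (hq l).1,
      mul_le_one₀ (hr g).2.le (hq l).1 (hq l).2⟩) fun l => by
      simp_rw [mul_sub, Finset.sum_sub_distrib, ← Finset.sum_mul, sum_stepMass hr_sum,
        sum_stepMass_mul_released]
      ring
  filter_upwards [hN, hS] with ω hN hS
  simp only [Finset.sum_sub_distrib, ← Finset.mul_sum, ← count_group_history G X Y,
    ← count_accepted_history, Finset.sum_const, Finset.card_range, nsmul_eq_mul] at hN hS
  set N : ℕ → ℝ := fun t => (((releasedHistory (history G X Y t ω)).map Prod.fst).count g : ℝ)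
  set A : ℕ → ℝ := fun t => ((releasedHistory (history G X Y t ω)).count (g, true) : ℝ)
  set Q : ℕ → ℝ := fun t => (∑ i ∈ Finset.range t, acceptProb p ζ κ (fairness G X Y i ω) g) / t
  have hNr : Tendsto (fun t : ℕ => N t / t) atTop (𝓝 (r g)) := by
    have h1 := hN.add_const (r g)
    rw [zero_add] at h1
    refine h1.congr' ?_
    filter_upwards [eventually_ge_atTop 1] with t ht
    have : (t : ℝ) ≠ 0 := by positivity
    simp only [N]
    field_simp
    ring
  have hQ : ∀ t, |Q t| ≤ 1 := by
    intro t
    have h0 : 0 ≤ ∑ i ∈ Finset.range t, acceptProb p ζ κ (fairness G X Y i ω) g :=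
      Finset.sum_nonneg fun i _ => (hq _).1
    rw [abs_of_nonneg (by positivity)]
    refine div_le_one_of_le₀ ?_ (by positivity)
    have := Finset.sum_le_card_nsmul (Finset.range t)
      (fun i => acceptProb p ζ κ (fairness G X Y i ω) g) 1 fun i _ => (hq _).2
    simpa using this
  have hQN : Tendsto (fun t : ℕ => Q t * (N t / t - r g)) atTop (𝓝 0) := by
    have h1 : Tendsto (fun t : ℕ => |N t / t - r g|) atTop (𝓝 0) := by
      simpa using (hNr.sub_const (r g)).abs
    refine squeeze_zero_norm (fun t => ?_) h1
    rw [norm_mul]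
    exact mul_le_of_le_one_left (norm_nonneg _) (hQ t)
  have hlim := (hS.sub hQN).div hNr (hr g).1.ne'
  rw [sub_zero, zero_div] at hlim
  refine hlim.congr' ?_
  filter_upwards [eventually_ge_atTop 1, hNr.eventually_ne (hr g).1.ne'] with t ht hne
  have ht0 : (t : ℝ) ≠ 0 := by positivity
  have hN0 : N t ≠ 0 := fun h0 => hne (by rw [h0, zero_div])
  change (((A t - r g * ∑ i ∈ Finset.range t, acceptProb p ζ κ (fairness G X Y i ω) g) / t -
    Q t * (N t / t - r g)) / (N t / t)) = A t / N t - Q t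
  simp only [Q]
  field_simp
  ring

theorem IsShieldedProcess.ae_tendsto_fairness
    (h : IsShieldedProcess G X Y P r p (energyShield ζ κ)) (hζ : IsEnergyFunction ζ κ)
    (hr : ∀ g, r g ∈ Set.Ioo (0 : ℝ) 1) (hr_sum : r .A + r .B = 1)
    (hp : ∀ g, p g ∈ Set.Ioo (0 : ℝ) 1) {μ : ℝ} (hμ : μ ∈ Set.Icc (-1 : ℝ) 1)
    (hfix : drift ζ κ (p .A - p .B) μ = μ) :
    ∀ᵐ ω ∂P, Tendsto (fun t => fairness G X Y t ω) atTop (𝓝 μ) := by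
  have hd : p .A - p .B ∈ Set.Icc (-1 : ℝ) 1 := by
    constructor <;> linarith [(hp .A).1, (hp .A).2, (hp .B).1, (hp .B).2]
  filter_upwards [h.ae_tendsto_acceptanceRate_sub hζ hr hr_sum hp .A,
    h.ae_tendsto_acceptanceRate_sub hζ hr hr_sum hp .B] with ω hA hB
  refine tendsto_fixedPoint_of_sub_average (hζ.continuousOn_drift _) (hζ.antitoneOn_drift hd)
    (hζ.mapsTo_drift hd) hμ hfix (fun n => rateDifference_mem_Icc _) ?_
  have hAB := hA.sub hB
  rw [sub_zero] at hAB
  refine hAB.congr fun t => ?_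
  simp only [← acceptProb_sub hζ.pivot_eq_zero, Finset.sum_sub_distrib]
  simp only [fairness, rateDifference]
  ring

theorem IsShieldedProcess.tendsto_integral_averageCost
    (h : IsShieldedProcess G X Y P r p (energyShield ζ κ)) (hζ : IsEnergyFunction ζ κ)
    {μ : ℝ} (hμ : μ ∈ Set.Icc (-1 : ℝ) 1)
    (hlim : ∀ᵐ ω ∂P, Tendsto (fun t => fairness G X Y t ω) atTop (𝓝 μ)) :
    Tendsto (fun t => ∫ ω, averageCost Y t ω ∂P) atTop (𝓝 (flipProb r p ζ κ μ)) := by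
  have hstep := fun t => h.integrable_and_integral_step t fun _ s => if s.2.2 then 1 else 0
  simp only [sum_stepMass_mul_flip hζ.pivot_eq_zero] at hstep
  have hcont := hζ.continuousOn_flipProb r p
  obtain ⟨C, hC⟩ := isCompact_Icc.exists_bound_of_continuousOn hcont
  have hflip : Tendsto (fun t => ∫ ω, flipProb r p ζ κ (fairness G X Y t ω) ∂P) atTop
      (𝓝 (flipProb r p ζ κ μ)) := by
    have hconst : ∫ _ : Ω, flipProb r p ζ κ μ ∂P = flipProb r p ζ κ μ := by simp
    rw [← hconst]
    refine tendsto_integral_of_dominated_convergence (fun _ => C)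
      (fun t => (h.integrable_comp_history t fun l =>
        flipProb r p ζ κ (rateDifference (releasedHistory l))).aestronglyMeasurable)
      (integrable_const C)
      (fun t => Eventually.of_forall fun ω => hC _ (rateDifference_mem_Icc _)) ?_
    filter_upwards [hlim] with ω hω
    exact (hcont μ hμ).tendsto.comp (tendsto_nhdsWithin_iff.2
      ⟨hω, Eventually.of_forall fun t => rateDifference_mem_Icc _⟩)
  refine hflip.cesaro.congr fun t => ?_
  simp only [averageCost]
  rw [integral_div, integral_finsetSum _ fun i _ => (hstep i).1, inv_mul_eq_div]
  congr 1
  exact Finset.sum_congr rfl fun i _ => (hstep i).2.symm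

end Convergence

end FairShield

theorem mainTheorem5 {Ω : Type*} [MeasurableSpace Ω] (P : Measure Ω) [IsProbabilityMeasure P]
    (r p : FairShield.Demographic → ℝ)
    (hr : ∀ g, r g ∈ Set.Ioo (0 : ℝ) 1)
    (hr_sum : r FairShield.Demographic.A + r FairShield.Demographic.B = 1)
    (hp : ∀ g, p g ∈ Set.Ioo (0 : ℝ) 1)
    (d : ℝ) (hd : d = p FairShield.Demographic.A - p FairShield.Demographic.B)
    (ζ : ℝ → ℝ) (κ : ℝ) (hζ : FairShield.IsEnergyFunction ζ κ)
    (G : ℕ → Ω → FairShield.Demographic) (X Y : ℕ → Ω → Bool)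
    (hGXY : FairShield.IsShieldedProcess G X Y P r p (FairShield.energyShield ζ κ))
    (μ : ℝ) (hμ : μ ∈ Set.Icc (-1 : ℝ) 1) :
    ((∀ᵐ ω ∂P, Tendsto (fun t => FairShield.fairness G X Y t ω) atTop (𝓝 μ)) ↔
      μ ∈ Set.uIcc d κ ∧
        ζ μ = if d < μ then (μ - d) / (1 - d) else (d - μ) / (1 + d)) ∧
    ∃ c : ℝ, Tendsto (fun t => ∫ ω, FairShield.averageCost Y t ω ∂P) atTop (𝓝 c) ∧
      ((∀ᵐ ω ∂P, Tendsto (fun t => FairShield.fairness G X Y t ω) atTop (𝓝 μ)) →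
        (μ ≠ d → c < |μ - d|) ∧ (μ = d → c = 0)) := by
  subst hd
  have hd : p .A - p .B ∈ Set.Ioo (-1 : ℝ) 1 := by
    constructor <;> linarith [(hp .A).1, (hp .A).2, (hp .B).1, (hp .B).2]
  have hd' := Set.Ioo_subset_Icc_self hd
  obtain ⟨μ₀, hμ₀, hfix⟩ := exists_mem_Icc_isFixedPt_of_mapsTo
    (hζ.continuousOn_drift (p .A - p .B)) (by norm_num) (hζ.mapsTo_drift hd')
  have hlim := hGXY.ae_tendsto_fairness hζ hr hr_sum hp hμ₀ hfix
  have huniq : (∀ᵐ ω ∂P, Tendsto (fun t => FairShield.fairness G X Y t ω) atTop (𝓝 μ)) →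
      μ = μ₀ := fun hconv => by
    obtain ⟨ω, h1, h2⟩ := (hconv.and hlim).exists
    exact tendsto_nhds_unique h1 h2
  refine ⟨?_, FairShield.flipProb r p ζ κ μ₀,
    hGXY.tendsto_integral_averageCost hζ hμ₀ hlim, fun hconv => ?_⟩
  · rw [← hζ.drift_eq_self_iff hd hμ]
    refine ⟨fun hconv => ?_, hGXY.ae_tendsto_fairness hζ hr hr_sum hp hμ⟩
    rw [huniq hconv]
    exact hfix
  · obtain rfl := huniq hconv
    refine ⟨hζ.flipProb_lt hr hp hμ hfix, ?_⟩
    intro heq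
    rw [heq] at hfix ⊢
    exact hζ.flipProb_eq_zero hd hfix
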